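/- Let $\Phi_a\subset\mathbb{R}^2$ be a homogeneous Poisson point process of density $\lambda_a>0$. Let $x^*=\arg\min_{x\in\Phi_a}|x|$ be its point closest to the origin $o$, and let $\mathcal{V}^*=\{y\in\mathbb{R}^2: |y-x^*|<|y-x| \text{ for all } x\in\Phi_a\setminus\{x^*\}\}$ be the Voronoi cell of $x^*$. For fixed $x,z\in\mathbb{R}^2$ let $$p_c(x\mid z)=\mathbb{P}(x\in\mathcal{V}^*\mid x^*=z)=\lim_{\varepsilon\downarrow 0}\mathbb{P}\big(x\in\mathcal{V}^*\,\big|\,|x^*-z|<\varepsilon\big)$$ be the probabilistic cell area (PCA) function. Then for every $z\in\mathbb{R}^2$ (including $z=o$) the limit exists for all $x\in\mathbb{R}^2$, and $$p_c(x\mid z)\ \ge\ e^{-\lambda_a\pi|x-z|^2}\qquad\text{for all }x\in\mathbb{R}^2 .$$ The two sides are equal as functions of $x$ (that is, for all $x\in\mathbb{R}^2$) if and only if $z=o$. More precisely, if $z\ne o$, then equality holds at a point $x$ if and only if $x=tz$ for some $t\ge 1$, so the inequality is strict at every $x$ outside this ray. -/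

import Mathlib

open MeasureTheory ProbabilityTheory Filter Topology

/-- The Euclidean plane, with the Euclidean norm and Lebesgue measure (area). -/
abbrev Plane : Type := EuclideanSpace ℝ (Fin 2)

/-- `Φ` is a homogeneous Poisson point process of density `lam` in the plane: a random locally
finite set of points such that the number of points in a bounded Borel set `A` is a Poisson random
variable of mean `lam * |A|`, and the numbers of points in finitely many pairwise disjoint bounded
Borel sets are independent. -/
structure IsHPPP {Ω : Type*} [MeasurableSpace Ω] (P : Measure Ω) (lam : ℝ)
    (Φ : Ω → Set Plane) : Prop where
  locallyFinite : ∀ (ω : Ω) (A : Set Plane), Bornology.IsBounded A → (Φ ω ∩ A).Finite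
  measurable_count : ∀ A : Set Plane, Bornology.IsBounded A → MeasurableSet A →
    Measurable fun ω => (Φ ω ∩ A).ncard
  law_count : ∀ A : Set Plane, Bornology.IsBounded A → MeasurableSet A →
    P.map (fun ω => (Φ ω ∩ A).ncard) = poissonMeasure (lam * volume.real A).toNNReal
  indep_count : ∀ (n : ℕ) (A : Fin n → Set Plane), (∀ i, Bornology.IsBounded (A i)) →
    (∀ i, MeasurableSet (A i)) → Pairwise (fun i j => Disjoint (A i) (A j)) →
    iIndepFun (fun i ω => (Φ ω ∩ A i).ncard) P

open Classical in
/-- The point of `S` closest to the origin. (Such a point exists when `S` is nonempty and locally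
finite; for a Poisson point process it almost surely exists and is unique. A tie is broken
arbitrarily, and the value is `0` if there is no closest point.) -/
noncomputable def nearestPoint (S : Set Plane) : Plane :=
  if h : ∃ a ∈ S, ∀ b ∈ S, ‖a‖ ≤ ‖b‖ then h.choose else 0

/-- The Voronoi cell, in the tessellation generated by `S`, of the point of `S` that is closest
to the origin. -/
def nearestCell (S : Set Plane) : Set Plane :=
  {y | ∀ a ∈ S \ {nearestPoint S}, ‖y - nearestPoint S‖ < ‖y - a‖}

/-- The elementary conditional probability that `x` lies in the Voronoi cell of the point of `Φ`
closest to the origin, given that this closest point lies in the open ball of radius `ε`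
around `xs`. -/
noncomputable def localCellProb {Ω : Type*} [MeasurableSpace Ω] (P : Measure Ω)
    (Φ : Ω → Set Plane) (x xs : Plane) (ε : ℝ) : ℝ :=
  P.real {ω | x ∈ nearestCell (Φ ω) ∧ nearestPoint (Φ ω) ∈ Metric.ball xs ε} /
    P.real {ω | nearestPoint (Φ ω) ∈ Metric.ball xs ε}

/-- The probabilistic cell area `p_c(x ∣ xs)`: the conditional probability that `x` lies in the
Voronoi cell of the point of `Φ` closest to the origin, given that this closest point is located
at `xs`. Since the location of the closest point has a diffuse law, conditioning on its value `xs`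
(including `xs = 0`, where an atom of the process is placed at the origin) is understood as
conditioning on the location being in a ball around `xs` of radius tending to `0`; by
differentiation of measures this gives a version of the conditional probability given the location
of the closest point. -/
noncomputable def cellProb {Ω : Type*} [MeasurableSpace Ω] (P : Measure Ω)
    (Φ : Ω → Set Plane) (x xs : Plane) : ℝ :=
  limUnder (𝓝[>] (0 : ℝ)) (localCellProb P Φ x xs)

open Metric

/-! Given that the nearest point is at `z`, the process has no points in the ball of radius `‖z‖`
about the origin, and `x` lies in the cell of `z` when the ball `ball x ‖x - z‖` has no other points
either. Independence over disjoint sets leaves the void probability of the part not already known to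
be empty, so the limit is `exp (-lam * |ball x ‖x - z‖ \ ball 0 ‖z‖|)`
(`IsHPPP.tendsto_localCellProb`). The bound follows by enlarging the difference to the whole disc.
Equality means that the two open discs meet in a null set, hence are disjoint
(`volume_real_ball_sdiff_eq_iff`). For `z ≠ 0` this is equality in the triangle inequality, which
gives the ray (`disjoint_balls_iff_exists_smul`); for `z = 0` the second disc is empty. -/

/-! ### Deterministic geometry of the nearest point and its cell -/

lemma nearestPoint_spec {S : Set Plane} (hS : ∀ A, Bornology.IsBounded A → (S ∩ A).Finite)
    (hne : S.Nonempty) : nearestPoint S ∈ S ∧ ∀ b ∈ S, ‖nearestPoint S‖ ≤ ‖b‖ := by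
  have h : ∃ a ∈ S, ∀ b ∈ S, ‖a‖ ≤ ‖b‖ := by
    obtain ⟨s, hs⟩ := hne
    obtain ⟨a, ha, hmin⟩ := Set.exists_min_image (S ∩ closedBall 0 ‖s‖) norm
      (hS _ isBounded_closedBall) ⟨s, hs, by simp⟩
    refine ⟨a, ha.1, fun b hb => ?_⟩
    by_cases hbs : ‖b‖ ≤ ‖s‖
    · exact hmin b ⟨hb, by simpa using hbs⟩
    · exact (by simpa using ha.2 : ‖a‖ ≤ ‖s‖).trans (le_of_not_ge hbs)
  rw [nearestPoint, dif_pos h]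
  exact h.choose_spec

/-- The only point in `ball z ε` has norm below `‖z‖ + ε`, so a different nearest point would lie in
`C`, which holds no other point. -/
lemma nearestPoint_of_unique {S : Set Plane}
    (hS : ∀ A, Bornology.IsBounded A → (S ∩ A).Finite) {z : Plane} {ε : ℝ}
    {C : Set Plane} (hC : Bornology.IsBounded C) (hsub : ball 0 (‖z‖ + ε) ⊆ C)
    (h1 : (S ∩ ball z ε).ncard = 1) (h0 : (S ∩ (C \ ball z ε)).ncard = 0) :
    nearestPoint S ∈ ball z ε ∧ ∀ a ∈ S \ {nearestPoint S}, a ∉ C := by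
  obtain ⟨p, hp⟩ := Set.ncard_eq_one.1 h1
  have hpm : p ∈ S ∩ ball z ε := hp ▸ Set.mem_singleton p
  have h0' := (Set.ncard_eq_zero (hS _ (hC.subset Set.sdiff_subset))).1 h0
  have hpn : ‖p‖ < ‖z‖ + ε := by
    have := norm_add_le z (p - z)
    have h2 : ‖p - z‖ < ε := mem_ball_iff_norm.1 hpm.2
    rw [add_sub_cancel] at this
    linarith
  have key : ∀ a ∈ S, a ≠ p → a ∉ C := by
    intro a ha hap haC
    by_cases hab : a ∈ ball z ε
    · exact hap (by simpa [hp] using (show a ∈ S ∩ ball z ε from ⟨ha, hab⟩))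
    · exact Set.eq_empty_iff_forall_notMem.1 h0' a ⟨ha, haC, hab⟩
  have hnp := nearestPoint_spec hS ⟨p, hpm.1⟩
  have heq : nearestPoint S = p := by
    by_contra hne
    exact key _ hnp.1 hne (hsub (by simpa using (hnp.2 p hpm.1).trans_lt hpn))
  rw [heq]
  exact ⟨hpm.2, fun a ha => key a ha.1 ha.2⟩

lemma mem_nearestCell_of_unique {S : Set Plane}
    (hS : ∀ A, Bornology.IsBounded A → (S ∩ A).Finite) {x z : Plane} {ε : ℝ}
    (h1 : (S ∩ ball z ε).ncard = 1)
    (h0 : (S ∩ ((ball 0 (‖z‖ + ε) ∪ ball x (‖x - z‖ + ε)) \ ball z ε)).ncard = 0) :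
    x ∈ nearestCell S ∧ nearestPoint S ∈ ball z ε := by
  obtain ⟨hb, hC⟩ := nearestPoint_of_unique hS (isBounded_ball.union isBounded_ball)
    Set.subset_union_left h1 h0
  refine ⟨fun a ha => ?_, hb⟩
  have h2 : ‖nearestPoint S - z‖ < ε := mem_ball_iff_norm.1 hb
  have h3 : ¬ ‖x - a‖ < ‖x - z‖ + ε := fun h => hC a ha (Or.inr (mem_ball_iff_norm'.2 h))
  have h4 := norm_sub_le (x - z) (nearestPoint S - z)
  rw [sub_sub_sub_cancel_right] at h4
  linarith

/-- Nonemptiness matters: for empty `S` the default value `0` of `nearestPoint` may lie in the ball.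
-/
lemma ncard_of_nearestPoint_mem {S : Set Plane}
    (hS : ∀ A, Bornology.IsBounded A → (S ∩ A).Finite) (hne : S.Nonempty) {z : Plane} {ε : ℝ}
    {C : Set Plane} (hb : nearestPoint S ∈ ball z ε) (hC : ∀ a ∈ S, a ∈ C → a ∈ ball z ε) :
    (S ∩ ball z ε).ncard ≠ 0 ∧ (S ∩ (C \ ball z ε)).ncard = 0 := by
  refine ⟨fun h => ?_, ?_⟩
  · have := (Set.ncard_eq_zero (hS _ isBounded_ball)).1 h
    exact Set.eq_empty_iff_forall_notMem.1 this _ ⟨(nearestPoint_spec hS hne).1, hb⟩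
  · have : S ∩ (C \ ball z ε) = ∅ :=
      Set.eq_empty_iff_forall_notMem.2 fun a ha => ha.2.2 (hC a ha.1 ha.2.1)
    rw [this, Set.ncard_empty]

lemma notMem_ball_of_nearestPoint_mem {S : Set Plane}
    (hS : ∀ A, Bornology.IsBounded A → (S ∩ A).Finite) {z : Plane} {ε : ℝ}
    (hb : nearestPoint S ∈ ball z ε) {a : Plane} (ha : a ∈ S) : a ∉ ball 0 (‖z‖ - ε) := by
  intro h
  have h1 := (nearestPoint_spec hS ⟨a, ha⟩).2 a ha
  have h2 : ‖nearestPoint S - z‖ < ε := mem_ball_iff_norm.1 hb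
  have h3 : ‖a‖ < ‖z‖ - ε := by simpa using h
  have h4 := norm_sub_norm_le z (nearestPoint S)
  rw [norm_sub_rev] at h4
  linarith

lemma eq_nearestPoint_of_mem_nearestCell {S : Set Plane} {x z : Plane} {ε : ℝ}
    (hx : x ∈ nearestCell S) (hb : nearestPoint S ∈ ball z ε) {a : Plane} (ha : a ∈ S)
    (hax : a ∈ ball x (‖x - z‖ - ε)) : a = nearestPoint S := by
  by_contra hne
  have h1 := hx a ⟨ha, hne⟩
  have h2 : ‖nearestPoint S - z‖ < ε := mem_ball_iff_norm.1 hb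
  have h3 : ‖x - a‖ < ‖x - z‖ - ε := mem_ball_iff_norm'.1 hax
  have h4 := norm_add_le (x - nearestPoint S) (nearestPoint S - z)
  rw [sub_add_sub_cancel] at h4
  linarith

/-! ### Areas of balls and of unions of two balls -/

lemma volume_real_ball_plane (c : Plane) (r : ℝ) :
    volume.real (ball c r) = max r 0 ^ 2 * Real.pi := by
  rw [measureReal_def, EuclideanSpace.volume_ball_fin_two, ENNReal.toReal_mul, ENNReal.toReal_pow,
    ENNReal.toReal_ofReal', ENNReal.toReal_ofReal Real.pi_pos.le]

/-- The added region is covered by the two annuli, so no formula for the area of a lens is needed.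
-/
lemma volume_real_union_balls_le (c d : Plane) {r s r' s' : ℝ} (hr : r ≤ r') (hs : s ≤ s') :
    volume.real (ball c r' ∪ ball d s') - volume.real (ball c r ∪ ball d s) ≤
      (volume.real (ball c r') - volume.real (ball c r)) +
      (volume.real (ball d s') - volume.real (ball d s)) := by
  have hsub : ball c r' ∪ ball d s' ⊆
      (ball c r ∪ ball d s) ∪ ((ball c r' \ ball c r) ∪ (ball d s' \ ball d s)) := by
    intro y hy
    by_cases h1 : y ∈ ball c r <;> by_cases h2 : y ∈ ball d s <;>
      simp_all only [Set.mem_union, Set.mem_sdiff, true_or, or_true, not_false_iff, and_true,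
        or_self]
  have h1 := measureReal_mono (μ := volume) hsub
    (((isBounded_ball.union isBounded_ball).union
      ((isBounded_ball.subset Set.sdiff_subset).union
        (isBounded_ball.subset Set.sdiff_subset))).measure_lt_top.ne)
  have h2 := measureReal_union_le (μ := (volume : Measure Plane)) (ball c r ∪ ball d s)
    ((ball c r' \ ball c r) ∪ (ball d s' \ ball d s))
  have h3 := measureReal_union_le (μ := (volume : Measure Plane))
    (ball c r' \ ball c r) (ball d s' \ ball d s)
  rw [measureReal_sdiff (ball_subset_ball hr) measurableSet_ball measure_ball_lt_top.ne,
    measureReal_sdiff (ball_subset_ball hs) measurableSet_ball measure_ball_lt_top.ne] at h3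
  linarith

lemma continuous_volume_real_ball (c : Plane) (r : ℝ) :
    Continuous fun δ => volume.real (ball c (r + δ)) := by
  simp_rw [volume_real_ball_plane]
  fun_prop

lemma tendsto_volume_real_union_balls (c d : Plane) (r s : ℝ) :
    Tendsto (fun δ => volume.real (ball c (r + δ) ∪ ball d (s + δ))) (𝓝 0)
      (𝓝 (volume.real (ball c r ∪ ball d s))) := by
  have hc := (continuous_volume_real_ball c r).tendsto 0
  have hd := (continuous_volume_real_ball d s).tendsto 0
  simp only [add_zero] at hc hd
  have hlim := (hc.sub_const (volume.real (ball c r))).abs.add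
    (hd.sub_const (volume.real (ball d s))).abs
  simp only [sub_self, abs_zero, add_zero] at hlim
  rw [tendsto_iff_dist_tendsto_zero]
  refine squeeze_zero (fun _ => dist_nonneg) (fun δ => ?_) hlim
  rw [Real.dist_eq]
  have bdd : ∀ u v : ℝ, (volume : Measure Plane) (ball c u ∪ ball d v) ≠ ⊤ := fun u v =>
    (isBounded_ball.union isBounded_ball).measure_lt_top.ne
  rcases le_total 0 δ with h | h
  · have h1 := volume_real_union_balls_le c d (r := r) (s := s) (r' := r + δ) (s' := s + δ)
      (by linarith) (by linarith)
    have h2 := measureReal_mono (μ := volume) (Set.union_subset_union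
      (ball_subset_ball (x := c) (show r ≤ r + δ by linarith))
      (ball_subset_ball (x := d) (show s ≤ s + δ by linarith))) (bdd _ _)
    rw [abs_of_nonneg (by linarith)]
    exact h1.trans (add_le_add (le_abs_self _) (le_abs_self _))
  · have h1 := volume_real_union_balls_le c d (r := r + δ) (s := s + δ) (r' := r) (s' := s)
      (by linarith) (by linarith)
    have h2 := measureReal_mono (μ := volume) (Set.union_subset_union
      (ball_subset_ball (x := c) (show r + δ ≤ r by linarith))
      (ball_subset_ball (x := d) (show s + δ ≤ s by linarith))) (bdd _ _)
    rw [abs_of_nonpos (by linarith), neg_sub]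
    refine h1.trans (add_le_add ?_ ?_) <;> exact (neg_sub _ _).symm.trans_le (neg_le_abs _)

/-! ### Probability estimates and the limit -/

section Poisson

variable {Ω : Type*} [MeasurableSpace Ω] {P : Measure Ω} {lam : ℝ} {Φ : Ω → Set Plane}

lemma IsHPPP.prob_count_eq (hlam : 0 ≤ lam) (hΦ : IsHPPP P lam Φ) {A : Set Plane}
    (hb : Bornology.IsBounded A) (hm : MeasurableSet A) (k : ℕ) :
    P.real {ω | (Φ ω ∩ A).ncard = k} =
      Real.exp (-(lam * volume.real A)) * (lam * volume.real A) ^ k / k.factorial := by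
  have h := map_measureReal_apply (μ := P) (hΦ.measurable_count A hb hm) (measurableSet_singleton k)
  rw [hΦ.law_count A hb hm, poissonMeasure_real_singleton,
    Real.coe_toNNReal _ (mul_nonneg hlam measureReal_nonneg)] at h
  exact h.symm

lemma IsHPPP.prob_inter [IsProbabilityMeasure P] (hlam : 0 ≤ lam) (hΦ : IsHPPP P lam Φ)
    {A C : Set Plane} (hA : Bornology.IsBounded A) (hC : Bornology.IsBounded C)
    (hAm : MeasurableSet A) (hCm : MeasurableSet C) (hd : Disjoint A C) (s : Set ℕ) :
    P.real {ω | (Φ ω ∩ A).ncard ∈ s ∧ (Φ ω ∩ C).ncard = 0} =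
      P.real {ω | (Φ ω ∩ A).ncard ∈ s} * Real.exp (-(lam * volume.real C)) := by
  have hind := hΦ.indep_count 2 ![A, C] (by simp [Fin.forall_fin_two, hA, hC])
    (by simp [Fin.forall_fin_two, hAm, hCm]) (by
      intro i j hij
      fin_cases i <;> fin_cases j <;> simp_all [disjoint_comm])
  have h := (hind.indepFun (show (0 : Fin 2) ≠ 1 by decide)).measure_inter_preimage_eq_mul s {0}
    (MeasurableSet.of_discrete) (measurableSet_singleton 0)
  have h2 := congrArg ENNReal.toReal h
  rw [ENNReal.toReal_mul] at h2
  have h3 := hΦ.prob_count_eq hlam hC hCm 0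
  simp only [pow_zero, mul_one, Nat.factorial_zero, Nat.cast_one, div_one] at h3
  rw [← h3]
  exact h2

/-- An empty process has no points in any ball of radius `n`, and these void probabilities tend to
`0`. -/
lemma IsHPPP.measure_empty [IsProbabilityMeasure P] (hlam : 0 < lam) (hΦ : IsHPPP P lam Φ) :
    P.real {ω | ¬ (Φ ω).Nonempty} = 0 := by
  have hle : ∀ n : ℕ, P.real {ω | ¬ (Φ ω).Nonempty} ≤
      Real.exp (-(lam * ((n : ℝ) ^ 2 * Real.pi))) := by
    intro n
    have h := hΦ.prob_count_eq hlam.le (isBounded_ball (x := 0) (r := n)) measurableSet_ball 0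
    rw [volume_real_ball_plane, max_eq_left n.cast_nonneg] at h
    simp only [pow_zero, mul_one, Nat.factorial_zero, Nat.cast_one, div_one] at h
    rw [← h]
    refine measureReal_mono fun ω hω => ?_
    simp [Set.not_nonempty_iff_eq_empty.1 hω]
  have ht : Tendsto (fun n : ℕ => Real.exp (-(lam * ((n : ℝ) ^ 2 * Real.pi)))) atTop (𝓝 0) :=
    Real.tendsto_exp_neg_atTop_nhds_zero.comp (Tendsto.const_mul_atTop hlam
      (Tendsto.atTop_mul_const Real.pi_pos
        ((tendsto_pow_atTop two_ne_zero).comp tendsto_natCast_atTop_atTop)))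
  exact le_antisymm (ge_of_tendsto' ht hle) measureReal_nonneg

/-- Two-sided bound for an event that is squeezed between "exactly one point in `B`, none in
`C \ B`" and, up to emptiness of the process, "some point in `B`, none in `C' \ B`". -/
lemma IsHPPP.prob_bounds [IsProbabilityMeasure P] (hlam : 0 < lam) (hΦ : IsHPPP P lam Φ)
    {B C C' : Set Plane} (hB : Bornology.IsBounded B) (hC : Bornology.IsBounded C)
    (hC' : Bornology.IsBounded C') (hBm : MeasurableSet B) (hCm : MeasurableSet C)
    (hCm' : MeasurableSet C') {E : Set Ω}
    (hlow : ∀ ω, (Φ ω ∩ B).ncard = 1 → (Φ ω ∩ (C \ B)).ncard = 0 → ω ∈ E)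
    (hup : ∀ ω ∈ E, (Φ ω).Nonempty →
      (Φ ω ∩ B).ncard ≠ 0 ∧ (Φ ω ∩ (C' \ B)).ncard = 0) :
    lam * volume.real B * Real.exp (-(lam * (volume.real C + volume.real B))) ≤ P.real E ∧
    P.real E ≤ lam * volume.real B * Real.exp (-(lam * (volume.real C' - volume.real B))) := by
  have hm : 0 ≤ lam * volume.real B := mul_nonneg hlam.le measureReal_nonneg
  constructor
  -- `E` need not be measurable: only monotonicity and subadditivity are applied to it.
  · have h1 : P.real {ω | (Φ ω ∩ B).ncard ∈ ({1} : Set ℕ) ∧ (Φ ω ∩ (C \ B)).ncard = 0} ≤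
        P.real E := measureReal_mono fun ω hω => hlow ω hω.1 hω.2
    rw [hΦ.prob_inter hlam.le hB (hC.subset Set.sdiff_subset) hBm (hCm.diff hBm)
      Set.disjoint_sdiff_right] at h1
    simp only [Set.mem_singleton_iff] at h1
    rw [hΦ.prob_count_eq hlam.le hB hBm] at h1
    refine le_trans ?_ h1
    have h2 : volume.real (C \ B) ≤ volume.real C :=
      measureReal_mono Set.sdiff_subset hC.measure_lt_top.ne
    rw [mul_add, neg_add, Real.exp_add, pow_one, Nat.factorial_one, Nat.cast_one, div_one,
      mul_comm (Real.exp (-(lam * volume.real B))) (lam * volume.real B),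
      mul_assoc (lam * volume.real B) (Real.exp (-(lam * volume.real B)))]
    refine mul_le_mul_of_nonneg_left ?_ hm
    rw [mul_comm]
    gcongr
  · have h1 : P.real E ≤
        P.real {ω | (Φ ω ∩ B).ncard ∈ ({0}ᶜ : Set ℕ) ∧ (Φ ω ∩ (C' \ B)).ncard = 0} + 0 := by
      rw [← hΦ.measure_empty hlam]
      refine (measureReal_mono fun ω hω => ?_).trans (measureReal_union_le _ _)
      by_cases hne : (Φ ω).Nonempty
      · exact Or.inl (hup ω hω hne)
      · exact Or.inr hne
    rw [add_zero, hΦ.prob_inter hlam.le hB (hC'.subset Set.sdiff_subset) hBm (hCm'.diff hBm)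
      Set.disjoint_sdiff_right] at h1
    refine h1.trans (mul_le_mul ?_ ?_ (Real.exp_nonneg _) hm)
    -- With `m = lam * volume.real B`, the chance of some point in `B` is `1 - exp (-m) ≤ m`.
    · have h2 := measureReal_compl (μ := P)
        ((hΦ.measurable_count B hB hBm) (measurableSet_singleton 0))
      have h3 := hΦ.prob_count_eq hlam.le hB hBm 0
      simp only [pow_zero, mul_one, Nat.factorial_zero, Nat.cast_one, div_one] at h3
      have h4 : P.real ((fun ω => (Φ ω ∩ B).ncard) ⁻¹' {0}) = _ := h3
      rw [h4, probReal_univ] at h2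
      have h5 := Real.add_one_le_exp (-(lam * volume.real B))
      refine h2.trans_le ?_
      linarith
    · have h2 := measureReal_sdiff_add_inter (μ := volume) (s := C') hBm hC'.measure_lt_top.ne
      have h3 : volume.real (C' ∩ B) ≤ volume.real B :=
        measureReal_mono Set.inter_subset_right hB.measure_lt_top.ne
      gcongr
      linarith

lemma IsHPPP.prob_nearestPoint_bounds [IsProbabilityMeasure P] (hlam : 0 < lam)
    (hΦ : IsHPPP P lam Φ) (z : Plane) (ε : ℝ) :
    let b := volume.real (ball z ε)
    lam * b * Real.exp (-(lam * (volume.real (ball (0 : Plane) (‖z‖ + ε)) + b))) ≤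
      P.real {ω | nearestPoint (Φ ω) ∈ ball z ε} ∧
    P.real {ω | nearestPoint (Φ ω) ∈ ball z ε} ≤
      lam * b * Real.exp (-(lam * (volume.real (ball (0 : Plane) (‖z‖ + -ε)) - b))) := by
  refine hΦ.prob_bounds hlam isBounded_ball isBounded_ball isBounded_ball measurableSet_ball
    measurableSet_ball measurableSet_ball (fun ω h1 h0 => ?_) (fun ω hω hne => ?_)
  · exact (nearestPoint_of_unique (hΦ.locallyFinite ω) isBounded_ball subset_rfl h1 h0).1
  · refine ncard_of_nearestPoint_mem (hΦ.locallyFinite ω) hne hω fun a ha haC => ?_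
    exact (notMem_ball_of_nearestPoint_mem (hΦ.locallyFinite ω) hω ha haC).elim

lemma IsHPPP.prob_nearestCell_bounds [IsProbabilityMeasure P] (hlam : 0 < lam)
    (hΦ : IsHPPP P lam Φ) (x z : Plane) (ε : ℝ) :
    let b := volume.real (ball z ε)
    let W := fun δ => volume.real (ball (0 : Plane) (‖z‖ + δ) ∪ ball x (‖x - z‖ + δ))
    lam * b * Real.exp (-(lam * (W ε + b))) ≤
      P.real {ω | x ∈ nearestCell (Φ ω) ∧ nearestPoint (Φ ω) ∈ ball z ε} ∧
    P.real {ω | x ∈ nearestCell (Φ ω) ∧ nearestPoint (Φ ω) ∈ ball z ε} ≤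
      lam * b * Real.exp (-(lam * (W (-ε) - b))) := by
  have hbd : ∀ u v : ℝ, Bornology.IsBounded (ball (0 : Plane) u ∪ ball x v) :=
    fun u v => isBounded_ball.union isBounded_ball
  have hms : ∀ u v : ℝ, MeasurableSet (ball (0 : Plane) u ∪ ball x v) :=
    fun u v => measurableSet_ball.union measurableSet_ball
  refine hΦ.prob_bounds hlam isBounded_ball (hbd _ _) (hbd _ _) measurableSet_ball
    (hms _ _) (hms _ _) (fun ω h1 h0 => ?_) (fun ω hω hne => ?_)
  · exact mem_nearestCell_of_unique (hΦ.locallyFinite ω) h1 h0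
  · refine ncard_of_nearestPoint_mem (hΦ.locallyFinite ω) hne hω.2 fun a ha haC => ?_
    rcases haC with haC | haC
    · exact (notMem_ball_of_nearestPoint_mem (hΦ.locallyFinite ω) hω.2 ha haC).elim
    · rw [eq_nearestPoint_of_mem_nearestCell hω.1 hω.2 ha haC]
      exact hω.2

/-- Numerator and denominator share the factor `lam * b ε`, which cancels in the ratio; the
remaining exponentials squeeze it. -/
lemma IsHPPP.tendsto_localCellProb [IsProbabilityMeasure P] (hlam : 0 < lam)
    (hΦ : IsHPPP P lam Φ) (x z : Plane) :
    Tendsto (localCellProb P Φ x z) (𝓝[>] 0)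
      (𝓝 (Real.exp (-(lam * volume.real (ball x ‖x - z‖ \ ball 0 ‖z‖))))) := by
  set g : ℝ → ℝ := fun δ => volume.real (ball (0 : Plane) (‖z‖ + δ)) with hg
  set W : ℝ → ℝ := fun δ => volume.real (ball (0 : Plane) (‖z‖ + δ) ∪ ball x (‖x - z‖ + δ)) with hW
  set b : ℝ → ℝ := fun ε => volume.real (ball z ε) with hbdef
  have hdiff : volume.real (ball x ‖x - z‖ \ ball 0 ‖z‖) =
      volume.real (ball (0 : Plane) ‖z‖ ∪ ball x ‖x - z‖) - volume.real (ball (0 : Plane) ‖z‖) := by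
    rw [← measureReal_sdiff Set.subset_union_left measurableSet_ball
      (isBounded_ball.union isBounded_ball).measure_lt_top.ne, Set.union_sdiff_left]
  have hneg : Tendsto (fun ε : ℝ => -ε) (𝓝 0) (𝓝 0) := by
    simpa using (continuous_neg (G := ℝ)).tendsto 0
  have tg : Tendsto g (𝓝 0) (𝓝 (volume.real (ball (0 : Plane) ‖z‖))) := by
    simpa [hg] using (continuous_volume_real_ball 0 ‖z‖).tendsto 0
  have tW : Tendsto W (𝓝 0) (𝓝 (volume.real (ball (0 : Plane) ‖z‖ ∪ ball x ‖x - z‖))) :=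
    tendsto_volume_real_union_balls 0 x ‖z‖ ‖x - z‖
  have tb : Tendsto b (𝓝 0) (𝓝 0) := by
    have := (continuous_volume_real_ball z 0).tendsto 0
    simpa [volume_real_ball_plane, hbdef] using this
  -- Lower bound of the numerator over upper bound of the denominator; `tup` is the reverse.
  have tlow : Tendsto (fun ε => Real.exp (-(lam * (W ε + b ε - (g (-ε) - b ε))))) (𝓝[>] 0)
      (𝓝 (Real.exp (-(lam * volume.real (ball x ‖x - z‖ \ ball 0 ‖z‖))))) := by
    refine Tendsto.mono_left ?_ nhdsWithin_le_nhds
    have := (((tW.add tb).sub ((tg.comp hneg).sub tb)).const_mul lam).neg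
    rw [add_zero, sub_zero, ← hdiff] at this
    exact (Real.continuous_exp.tendsto _).comp this
  have tup : Tendsto (fun ε => Real.exp (-(lam * (W (-ε) - b ε - (g ε + b ε))))) (𝓝[>] 0)
      (𝓝 (Real.exp (-(lam * volume.real (ball x ‖x - z‖ \ ball 0 ‖z‖))))) := by
    refine Tendsto.mono_left ?_ nhdsWithin_le_nhds
    have := ((((tW.comp hneg).sub tb).sub (tg.add tb)).const_mul lam).neg
    rw [add_zero, sub_zero, ← hdiff] at this
    exact (Real.continuous_exp.tendsto _).comp this
  have hbpos : ∀ ε > 0, 0 < lam * b ε := fun ε hε => by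
    rw [hbdef]
    dsimp only
    rw [volume_real_ball_plane, max_eq_left hε.le]
    positivity
  refine tendsto_of_tendsto_of_tendsto_of_le_of_le' tlow tup ?_ ?_ <;>
    filter_upwards [self_mem_nhdsWithin] with ε hε
  all_goals
    obtain ⟨d1, d2⟩ := hΦ.prob_nearestPoint_bounds hlam z ε
    obtain ⟨n1, n2⟩ := hΦ.prob_nearestCell_bounds hlam x z ε
    have hb := hbpos ε hε
    have hD : 0 < P.real {ω | nearestPoint (Φ ω) ∈ ball z ε} :=
      (mul_pos hb (Real.exp_pos _)).trans_le d1
    rw [localCellProb]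
  · rw [le_div_iff₀ hD]
    refine (mul_le_mul_of_nonneg_left d2 (Real.exp_nonneg _)).trans (le_trans (le_of_eq ?_) n1)
    rw [mul_left_comm, ← Real.exp_add]
    congr 2
    ring
  · rw [div_le_iff₀ hD]
    refine n2.trans (le_trans (le_of_eq ?_) (mul_le_mul_of_nonneg_left d1 (Real.exp_nonneg _)))
    rw [mul_left_comm, ← Real.exp_add]
    congr 2
    ring

end Poisson

/-! ### The equality case -/

lemma disjoint_balls_iff_exists_smul {x z : Plane} (hz : z ≠ 0) :
    Disjoint (ball x ‖x - z‖) (ball 0 ‖z‖) ↔ ∃ t : ℝ, 1 ≤ t ∧ x = t • z := by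
  have hray : SameRay ℝ (x - z) z ↔ ∃ t : ℝ, 1 ≤ t ∧ x = t • z := by
    rw [← exists_nonneg_right_iff_sameRay hz]
    constructor
    · rintro ⟨s, hs, h⟩
      exact ⟨s + 1, by linarith, by rw [add_smul, one_smul, ← h, sub_add_cancel]⟩
    · rintro ⟨t, ht, rfl⟩
      exact ⟨t - 1, by linarith, by rw [sub_smul, one_smul]⟩
  rw [← hray]
  -- The disjointness criterion for balls needs positive radii; at `x = z` one ball is empty.
  rcases eq_or_ne x z with rfl | hxz
  · simp
  rw [disjoint_ball_ball_iff (norm_pos_iff.2 (sub_ne_zero.2 hxz)) (norm_pos_iff.2 hz),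
    dist_zero_right, sameRay_iff_norm_add, sub_add_cancel]
  refine ⟨fun h => le_antisymm ?_ h, fun h => h.ge⟩
  simpa using norm_add_le (x - z) z

/-- The intersection is open, so it is null only if it is empty. -/
lemma volume_real_ball_sdiff_eq_iff {c d : Plane} {r s : ℝ} :
    volume.real (ball c r \ ball d s) = volume.real (ball c r) ↔
      Disjoint (ball c r) (ball d s) := by
  have h := measureReal_sdiff_add_inter (μ := volume) (s := ball c r)
    (measurableSet_ball (x := d) (ε := s)) measure_ball_lt_top.ne
  rw [Set.disjoint_iff_inter_eq_empty,
    ← (isOpen_ball.inter isOpen_ball).measure_eq_zero_iff (volume : Measure Plane),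
    ← measureReal_eq_zero_iff (measure_lt_top_of_subset Set.inter_subset_left
      measure_ball_lt_top.ne).ne]
  constructor <;> intro h' <;> linarith

theorem corollary1 {Ω : Type*} [MeasurableSpace Ω] (P : Measure Ω) [IsProbabilityMeasure P]
    (lam : ℝ) (hlam : 0 < lam) (Φ : Ω → Set Plane) (hΦ : IsHPPP P lam Φ) (xs : Plane) :
    -- the limit that defines the conditional probability exists
    (∀ x : Plane, Tendsto (localCellProb P Φ x xs) (𝓝[>] (0 : ℝ)) (𝓝 (cellProb P Φ x xs))) ∧
    -- the lower bound
    (∀ x : Plane, Real.exp (-(lam * Real.pi * ‖x - xs‖ ^ 2)) ≤ cellProb P Φ x xs) ∧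
    -- the two functions of `x` are equal exactly when the closest point is the origin
    ((∀ x : Plane, cellProb P Φ x xs = Real.exp (-(lam * Real.pi * ‖x - xs‖ ^ 2))) ↔ xs = 0) ∧
    -- if it is not, then the bound is strict at every `x` off the ray from `xs` away from the
    -- origin, and is attained on that ray
    (xs ≠ 0 → ∀ x : Plane,
      (cellProb P Φ x xs = Real.exp (-(lam * Real.pi * ‖x - xs‖ ^ 2)) ↔
        ∃ t : ℝ, 1 ≤ t ∧ x = t • xs)) := by

  have hlim := hΦ.tendsto_localCellProb hlam
  have hval : ∀ x, cellProb P Φ x xs =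
      Real.exp (-(lam * volume.real (ball x ‖x - xs‖ \ ball 0 ‖xs‖))) :=
    fun x => (hlim x xs).limUnder_eq
  have hball : ∀ x : Plane, lam * Real.pi * ‖x - xs‖ ^ 2 = lam * volume.real (ball x ‖x - xs‖) := by
    intro x
    rw [volume_real_ball_plane, max_eq_left (norm_nonneg _)]
    ring
  have heq : ∀ x : Plane, cellProb P Φ x xs = Real.exp (-(lam * Real.pi * ‖x - xs‖ ^ 2)) ↔
      Disjoint (ball x ‖x - xs‖) (ball 0 ‖xs‖) := by
    intro x
    rw [hval, hball, Real.exp_eq_exp, neg_inj, mul_right_inj' hlam.ne',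
      volume_real_ball_sdiff_eq_iff]
  refine ⟨fun x => hval x ▸ hlim x xs, fun x => ?_, ⟨fun h => ?_, ?_⟩, fun hz x => ?_⟩
  · rw [hval, hball]
    gcongr
    · exact measure_ball_lt_top.ne
    · exact Set.sdiff_subset
  -- The point `x = 0` is off the ray, so equality fails there.
  · by_contra hz
    obtain ⟨t, ht, h0⟩ := (disjoint_balls_iff_exists_smul hz).1 ((heq 0).1 (h 0))
    rcases smul_eq_zero.1 h0.symm with rfl | h1
    · linarith
    · exact hz h1
  · rintro rfl x
    exact (heq x).2 (by simp)
  · rw [heq, disjoint_balls_iff_exists_smul hz]
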